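/- **Definitions.** Let $A$ be a countable abelian group (here $A=\mathbb Z^2$ or $A=\mathbb Z$). A measure-preserving action $\mathbf T$ of $A$ on a probability space $(X,\mu)$ is a family of measurable $\mu$-preserving maps $\mathbf T^{g}:X\to X$ $(g\in A)$ with $\mathbf T^{0}=\mathrm{id}$ and $\mathbf T^{g+h}=\mathbf T^{g}\circ\mathbf T^{h}$. It is *free* if for $\mu$-almost every $x$, $\mathbf T^{g}x=x$ implies $g=0$. It *factors onto* an action $\mathbf S$ of $A$ on $(Y,\nu)$ if there is a measurable $\phi:X\to Y$ (a *factor map*) that maps $\mu$ to $\nu$ and satisfies, for almost every $x$, $\phi(\mathbf T^{g}x)=\mathbf S^{g}\phi(x)$ for all $g\in A$; two actions are *conjugate* if there is a factor map from the first to the second that is almost surely one-to-one. A sequence $(F_n)$ of nonempty finite subsets of $\mathbb Z^2$ is a *Følner sequence* if $\#(F_n\,\triangle\,(F_n+v))/\#F_n\to 0$ for every $v\in\mathbb Z^2$. An action $\mathbf T$ of $\mathbb Z^2$ on $(X,\mu)$ is *Følner rank one* if there are a Følner sequence $(F_n)$ and measurable sets $B_n$ with $\mu(B_n)>0$ such that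 for each $n$ the levels $\mathbf T^{v}(B_n)$, $v\in F_n$, are pairwise disjoint, and such that for every measurable $C\subseteq X$ there are sets $L_n$, each a union of some of the levels $\mathbf T^v(B_n)$, $v\in F_n$, with $\mu(L_n\,\triangle\,C)\to0$. For a decreasing sequence $\mathfrak G=(G_1\supseteq G_2\supseteq\cdots)$ of finite-index subgroups of $A$, let $X_{\mathfrak G}=\varprojlim A/G_j$ with its Haar probability measure (on the $\sigma$-algebra generated by the cylinder sets), on which $v\in A$ acts by adding $v+G_j$ in the $j$-th coordinate. An *$A$-odometer* is any measure-preserving action of $A$ conjugate to such an action. The *dyadic $\mathbb Z$-odometer* is the one given by $G_j=2^j\mathbb Z\le\mathbb Z$, $j\ge1$. **Theorem.** There is a Følner rank one action $\mathbf T$ of $\mathbb Z^2$ on $[0,1]$ with Lebesgue measure such that each of the $\mathbb Z$-actions generated by $\mathbf T^{\mathbf e_1}$ and by $\mathbf T^{\mathbf e_2}$ factors onto the dyadic $\mathbb Z$-odometer, but $\mathbf T$ does not factor onto any free $\mathbb Z^2$-odometer. -/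

import Mathlib

open MeasureTheory Filter Topology

/-- A measure-preserving action of the (additive) group `G` on the measure space `(X, μ)`.
Invertibility of each `T g` follows from the group law. -/
structure MPAction (G : Type*) [AddGroup G] {X : Type*} [MeasurableSpace X]
    (μ : Measure X) where
  act : G → X → X
  measurePreserving : ∀ g, MeasurePreserving (act g) μ μ
  act_zero : ∀ x, act 0 x = x
  act_add : ∀ g h x, act (g + h) x = act g (act h x)

namespace MPAction

section Basic

variable {G : Type*} [AddGroup G]
  {X : Type*} [MeasurableSpace X] {μ : Measure X}
  {Y : Type*} [MeasurableSpace Y] {ν : Measure Y}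

/-- The action is free: almost every point has trivial stabilizer. -/
def IsFree (T : MPAction G μ) : Prop :=
  ∀ᵐ x ∂μ, ∀ g, T.act g x = x → g = 0

/-- `φ` is a factor map from `T` to `S`: it is measurable, maps `μ` to `ν`, and is almost
everywhere equivariant. -/
def IsFactorMap (T : MPAction G μ) (S : MPAction G ν) (φ : X → Y) : Prop :=
  MeasurePreserving φ μ ν ∧ ∀ᵐ x ∂μ, ∀ g, φ (T.act g x) = S.act g (φ x)

/-- `T` factors onto `S`. -/
def FactorsOnto (T : MPAction G μ) (S : MPAction G ν) : Prop :=
  ∃ φ : X → Y, IsFactorMap T S φ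

/-- `T` and `S` are conjugate: there is a factor map which is almost surely one-to-one. -/
def IsConjugate (T : MPAction G μ) (S : MPAction G ν) : Prop :=
  ∃ φ : X → Y, IsFactorMap T S φ ∧ ∃ N : Set X, μ Nᶜ = 0 ∧ Set.InjOn φ N

/-- The `ℤ`-action generated by the single transformation `T g`. -/
def cyclic (T : MPAction G μ) (g : G) : MPAction ℤ μ where
  act n := T.act (n • g)
  measurePreserving n := T.measurePreserving (n • g)
  act_zero x := by rw [zero_zsmul, T.act_zero]
  act_add m n x := by rw [add_zsmul, T.act_add]

/-- `B` is the base of a `T`-tower of shape `R`, whose levels are the sets `T v '' B`, `v ∈ R`. -/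
def IsTowerBase (T : MPAction G μ) (R : Finset G) (B : Set X) : Prop :=
  MeasurableSet B ∧ 0 < μ B ∧
    ∀ v ∈ R, ∀ w ∈ R, v ≠ w → Disjoint (T.act v '' B) (T.act w '' B)

/-- `T` is rank one for the sequence of shapes `F`: there are towers of shape `F n` such that every
measurable set is a limit in measure of unions of levels of these towers. -/
def IsRankOneFor (T : MPAction G μ) (F : ℕ → Finset G) : Prop :=
  (∀ n, (F n).Nonempty) ∧
  ∃ B : ℕ → Set X, (∀ n, T.IsTowerBase (F n) (B n)) ∧
    ∀ A : Set X, MeasurableSet A →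
      ∃ L : ℕ → Finset G, (∀ n, L n ⊆ F n) ∧
        Tendsto (fun n => μ (symmDiff (⋃ v ∈ L n, T.act v '' B n) A)) atTop (𝓝 0)

end Basic

end MPAction

open Classical in
/-- A sequence of shapes (nonempty finite sets) `F` is a Følner sequence for `G`. -/
def IsFolnerSeq {G : Type*} [AddGroup G] (F : ℕ → Finset G) : Prop :=
  (∀ n, (F n).Nonempty) ∧
  ∀ v : G, Tendsto
    (fun n => ((symmDiff (F n) ((F n).image (fun u => u + v))).card : ℝ) / ((F n).card : ℝ))
    atTop (𝓝 0)

/-- `T` is Følner rank one: it is rank one for some Følner sequence. -/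
def MPAction.IsFolnerRankOne {G : Type*} [AddGroup G] {X : Type*} [MeasurableSpace X]
    {μ : Measure X} (T : MPAction G μ) : Prop :=
  ∃ F : ℕ → Finset G, IsFolnerSeq F ∧ T.IsRankOneFor F

/-- A decreasing sequence of finite-index subgroups of `A`. -/
structure FiniteIndexChain (A : Type*) [AddCommGroup A] where
  grp : ℕ → AddSubgroup A
  antitone : Antitone grp
  finiteIndex : ∀ j, (grp j).FiniteIndex

namespace FiniteIndexChain

variable {A : Type*} [AddCommGroup A] (𝔊 : FiniteIndexChain A)

/-- The quotient map `A / G_{j+1} → A / G_j`. -/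
def proj (j : ℕ) : A ⧸ 𝔊.grp (j + 1) →+ A ⧸ 𝔊.grp j :=
  QuotientAddGroup.map (𝔊.grp (j + 1)) (𝔊.grp j) (AddMonoidHom.id A)
    (𝔊.antitone (Nat.le_succ j))

/-- The inverse limit of the groups `A / G_j`, as a subgroup of their product. -/
def limitSubgroup : AddSubgroup (∀ j, A ⧸ 𝔊.grp j) where
  carrier := {x | ∀ j, 𝔊.proj j (x (j + 1)) = x j}
  zero_mem' j := by simp
  add_mem' {x y} hx hy j := by
    simp only [Set.mem_ofPred_eq] at hx hy
    simp [hx j, hy j]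
  neg_mem' {x} hx j := by
    simp only [Set.mem_ofPred_eq] at hx
    simp [hx j]

/-- The phase space of the odometer. -/
def Space : Type _ := 𝔊.limitSubgroup

instance : AddCommGroup 𝔊.Space := inferInstanceAs (AddCommGroup 𝔊.limitSubgroup)

/-- The coordinate map to `A / G_j`. -/
def coord (j : ℕ) : 𝔊.Space →+ A ⧸ 𝔊.grp j :=
  (Pi.evalAddMonoidHom (fun j => A ⧸ 𝔊.grp j) j).comp 𝔊.limitSubgroup.subtype

/-- The cylinder sets: preimages of points under the coordinate maps. -/
def cylinders : Set (Set 𝔊.Space) :=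
  {s | ∃ (j : ℕ) (c : A ⧸ 𝔊.grp j), s = 𝔊.coord j ⁻¹' {c}}

/-- The topology induced by the product of the discrete topologies. -/
instance : TopologicalSpace 𝔊.Space :=
  ⨅ j, TopologicalSpace.induced (𝔊.coord j) ⊥

/-- The σ-algebra generated by the cylinder sets. -/
instance : MeasurableSpace 𝔊.Space := MeasurableSpace.generateFrom 𝔊.cylinders

theorem finite_quotient (j : ℕ) : Finite (A ⧸ 𝔊.grp j) :=
  have := 𝔊.finiteIndex j
  inferInstance

theorem countable_cylinders : 𝔊.cylinders.Countable := by
  have := 𝔊.finite_quotient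
  have h : 𝔊.cylinders =
      Set.range (fun p : (Σ j, A ⧸ 𝔊.grp j) => 𝔊.coord p.1 ⁻¹' {p.2}) := by
    ext s
    constructor
    · rintro ⟨j, c, rfl⟩
      exact ⟨⟨j, c⟩, rfl⟩
    · rintro ⟨⟨j, c⟩, rfl⟩
      exact ⟨j, c, rfl⟩
  rw [h]
  exact Set.countable_range _

theorem topology_eq :
    (inferInstance : TopologicalSpace 𝔊.Space) =
      TopologicalSpace.generateFrom 𝔊.cylinders := by
  apply le_antisymm
  · apply le_generateFrom
    rintro s ⟨j, c, rfl⟩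
    have h : TopologicalSpace.induced (𝔊.coord j) ⊥ ≥
        (inferInstance : TopologicalSpace 𝔊.Space) := iInf_le _ j
    exact h _ ⟨{c}, trivial, rfl⟩
  · refine le_iInf fun j => ?_
    rintro _ ⟨t, -, rfl⟩
    have : 𝔊.coord j ⁻¹' t = ⋃ c ∈ t, 𝔊.coord j ⁻¹' {c} := by
      ext x; simp
    rw [this]
    refine @isOpen_biUnion _ _ (TopologicalSpace.generateFrom 𝔊.cylinders) _ _ fun c _ => ?_
    exact TopologicalSpace.isOpen_generateFrom_of_mem ⟨j, c, rfl⟩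

instance : BorelSpace 𝔊.Space := by
  have : SecondCountableTopology 𝔊.Space :=
    ⟨⟨𝔊.cylinders, 𝔊.countable_cylinders, 𝔊.topology_eq⟩⟩
  exact ⟨(borel_eq_generateFrom_of_subbasis 𝔊.topology_eq).symm⟩

instance : IsTopologicalAddGroup 𝔊.Space := by
  refine topologicalAddGroup_iInf fun j => ?_
  let : TopologicalSpace (A ⧸ 𝔊.grp j) := ⊥
  have : DiscreteTopology (A ⧸ 𝔊.grp j) := ⟨rfl⟩
  exact topologicalAddGroup_induced (𝔊.coord j)

instance : CompactSpace 𝔊.Space := by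
  let : ∀ j, TopologicalSpace (A ⧸ 𝔊.grp j) := fun _ => ⊥
  have : ∀ j, DiscreteTopology (A ⧸ 𝔊.grp j) := fun _ => ⟨rfl⟩
  have := 𝔊.finite_quotient
  have hind : IsInducing (fun x : 𝔊.Space => fun j => 𝔊.coord j x) := by
    constructor
    simp only [Pi.topologicalSpace, induced_iInf, induced_compose]
    rfl
  have hcl : IsClosed (Set.range (fun x : 𝔊.Space => fun j => 𝔊.coord j x)) := by
    have : Set.range (fun x : 𝔊.Space => fun j => 𝔊.coord j x) =
        ⋂ j, {x : ∀ j, A ⧸ 𝔊.grp j | 𝔊.proj j (x (j + 1)) = x j} := by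
      ext x
      simp only [Set.mem_range, Set.mem_iInter, Set.mem_ofPred_eq]
      constructor
      · rintro ⟨y, rfl⟩ j
        exact y.2 j
      · intro h
        exact ⟨⟨x, h⟩, rfl⟩
    rw [this]
    exact isClosed_iInter fun j =>
      isClosed_eq (continuous_of_discreteTopology.comp (continuous_apply _)) (continuous_apply _)
  exact ⟨hind.isCompact_iff.2 (by rw [Set.image_univ]; exact hcl.isCompact)⟩

/-- The Haar probability measure on the phase space. -/
noncomputable def haar : Measure 𝔊.Space := Measure.addHaarMeasure ⊤

/-- The point of the phase space all of whose coordinates are the class of `v`. -/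
def diag (v : A) : 𝔊.Space := ⟨fun j => (v : A ⧸ 𝔊.grp j), fun _ => rfl⟩

/-- The odometer: `v` acts by adding the class of `v` in every coordinate. -/
noncomputable def odometer : MPAction A 𝔊.haar where
  act v x := 𝔊.diag v + x
  measurePreserving v := measurePreserving_add_left (Measure.addHaarMeasure ⊤) (𝔊.diag v)
  act_zero x := zero_add x
  act_add v w x := add_assoc (𝔊.diag v) (𝔊.diag w) x

end FiniteIndexChain

/-- An `A`-odometer: a measure-preserving action of `A` that is conjugate to the translation action
on the inverse limit of the quotients by a decreasing sequence of finite-index subgroups. -/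
def MPAction.IsOdometer {A : Type*} [AddCommGroup A] {Y : Type*} [MeasurableSpace Y]
    {ν : Measure Y} (S : MPAction A ν) : Prop :=
  ∃ 𝔊 : FiniteIndexChain A, S.IsConjugate 𝔊.odometer

/-- The sequence of subgroups `2ℤ ⊇ 4ℤ ⊇ 8ℤ ⊇ ⋯` of `ℤ`. -/
def dyadicChain : FiniteIndexChain ℤ where
  grp j := AddSubgroup.zmultiples (2 ^ (j + 1) : ℤ)
  antitone := antitone_nat_of_succ_le fun j =>
    AddSubgroup.zmultiples_le_of_mem
      (Int.mem_zmultiples_iff.2 (pow_dvd_pow 2 (Nat.le_succ (j + 1))))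
  finiteIndex j := ⟨by
    rw [Int.index_zmultiples]
    simp⟩

/-- The dyadic `ℤ`-odometer. -/
noncomputable def dyadicOdometer : MPAction ℤ dyadicChain.haar := dyadicChain.odometer

/-!
The action is built on the product of the dyadic integers `Z` and the circle `K = ℝ / ℤ`: for a
Liouville number `α`, the element `(a, b)` of `ℤ²` acts by `(z, w) ↦ (z + a + b, w + a α)`. Both
generators act on the first coordinate as the dyadic odometer, which gives the dyadic factors.

The element `u = (1, -1)` acts as `id × R_α`, where `R_α` is the rotation by `α`. If the action
factors onto an odometer with groups `G_j`, then the `j`-th coordinate of the factor map is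
invariant under `N u`, which acts as `id × R_{Nα}`, where `N` is the index of `G_j`. Irrational
rotations are ergodic, so this coordinate is constant on almost every fibre, hence invariant under
`u` itself, and therefore `u ∈ G_j` (`mem_grp_of_isFactorMap_dyadicCircleAction`). Thus `u`
acts trivially on the odometer, which is not free.

In the basis `(0, 1)`, `u` of `ℤ²` the action is the product of the odometer and of `R_α`. If
`p / q` is an excellent rational approximation to `α`, an arc of length slightly less than `1 / q`
has disjoint images under the first `q` powers of `R_α`, and these fill the circle almost entirely;
the odometer has exact towers of height `2 ^ n`. The products of these towers have shape a sheared
box, and their levels shrink to points, so the action is Følner rank one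
(`MPAction.isRankOneFor_of_shrinking`, `isFolnerRankOne_dyadicCircleAction`).

Finally, the distribution function of an atomless standard Borel probability space carries it to
`[0, 1]` injectively off a null set (`exists_measurePreserving_unitInterval`). Restricting to an
invariant conull set and letting the action fix the other points of `[0, 1]`
(`MPAction.transport`) preserves rank one and the factors.
-/

/-! ### Atomless standard Borel probability spaces -/

/-- A continuous distribution function is uniformly distributed: a proper nonempty sublevel set is a
half-line `Iic m`, and the function takes the value `t` at `m`. -/
theorem measure_preimage_cdf_Iic (ν : Measure ℝ) [IsProbabilityMeasure ν]
    (hc : Continuous (ProbabilityTheory.cdf ν)) {t : ℝ} (h0 : 0 ≤ t) (h1 : t ≤ 1) :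
    ν {x | ProbabilityTheory.cdf ν x ≤ t} = ENNReal.ofReal t := by
  set F := ProbabilityTheory.cdf ν with hF
  have hmono : Monotone F := ProbabilityTheory.monotone_cdf ν
  rcases h1.eq_or_lt with rfl | h1
  · have : {x | F x ≤ 1} = Set.univ := by
      ext x; simpa using ProbabilityTheory.cdf_le_one ν x
    rw [this]; simp
  set s := {x | F x ≤ t} with hs
  rcases s.eq_empty_or_nonempty with he | hne
  · have ht : t ≤ 0 := by
      refine ge_of_tendsto' (ProbabilityTheory.tendsto_cdf_atBot ν) fun x => ?_
      have : x ∉ s := by simp [he]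
      exact (not_le.1 this).le
    rw [he]; simp [ht]
  have hbdd : BddAbove s := by
    obtain ⟨b, hb⟩ := ((ProbabilityTheory.tendsto_cdf_atTop ν).eventually
      (lt_mem_nhds h1)).exists
    exact ⟨b, fun x hx => le_of_not_gt fun hlt => absurd (hmono hlt.le) (not_le.2 (hx.trans_lt hb))⟩
  have hcl : IsClosed s := isClosed_le hc continuous_const
  set m := sSup s
  have hm : m ∈ s := hcl.csSup_mem hne hbdd
  have hsm : s = Set.Iic m := by
    ext x
    exact ⟨fun hx => le_csSup hbdd hx, fun hx => (hmono hx).trans hm⟩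
  have hFm : F m = t := by
    refine le_antisymm hm (le_of_not_gt fun hlt => ?_)
    have hev : ∀ᶠ y in 𝓝[>] m, F y < t :=
      (hc.tendsto m).mono_left nhdsWithin_le_nhds |>.eventually (gt_mem_nhds hlt)
    obtain ⟨y, hy, hym⟩ := (hev.and self_mem_nhdsWithin).exists
    exact absurd (le_csSup hbdd (show y ∈ s from hy.le)) (not_le.2 hym)
  rw [hsm, ← ProbabilityTheory.ofReal_cdf, ← hF, hFm]

/-- The distribution function of an atomless probability measure on the line carries it to the
Lebesgue measure on the unit interval, and collapses only a null set. -/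
theorem exists_measurePreserving_unitInterval_of_real (ν : Measure ℝ) [IsProbabilityMeasure ν]
    [NullSingletonClass ν] :
    ∃ (F : ℝ → unitInterval) (N : Set ℝ), MeasurePreserving F ν volume ∧ MeasurableSet N ∧
      ν Nᶜ = 0 ∧ Set.InjOn F N := by
  have hmono := ProbabilityTheory.monotone_cdf ν
  have hc : Continuous (ProbabilityTheory.cdf ν) := by
    refine continuous_iff_continuousAt.2 fun x => ?_
    refine hmono.continuousAt_iff_leftLim_eq_rightLim.2 ?_
    have h1 := (ProbabilityTheory.cdf ν).measure_singleton x
    rw [ProbabilityTheory.measure_cdf, measure_singleton] at h1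
    have h2 := ENNReal.ofReal_eq_zero.1 h1.symm
    have h3 := (ProbabilityTheory.cdf ν).rightLim_eq x
    have h4 := hmono.leftLim_le (le_refl x)
    rw [h3]
    exact le_antisymm h4 (by linarith)
  set F : ℝ → unitInterval := fun x => ⟨ProbabilityTheory.cdf ν x,
    ProbabilityTheory.cdf_nonneg ν x, ProbabilityTheory.cdf_le_one ν x⟩ with hF
  have hFc : Continuous F := hc.subtype_mk _
  have hmp : MeasurePreserving F ν volume := by
    refine ⟨hFc.measurable, ?_⟩
    have := Measure.isProbabilityMeasure_map (μ := ν) hFc.measurable.aemeasurable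
    refine Measure.ext_of_Iic _ _ fun t => ?_
    rw [Measure.map_apply hFc.measurable measurableSet_Iic, unitInterval.volume_Iic]
    exact measure_preimage_cdf_Iic ν hc t.2.1 t.2.2
  set D : ℚ → Set ℝ := fun p => {y | ProbabilityTheory.cdf ν y ≤ ProbabilityTheory.cdf ν p} \
    Set.Iic (p : ℝ) with hD
  have hDm : ∀ p, MeasurableSet (D p) := fun p =>
    (isClosed_le hc continuous_const).measurableSet.diff measurableSet_Iic
  have hD0 : ∀ p, ν (D p) = 0 := fun p => by
    have hsub : Set.Iic (p : ℝ) ⊆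
        {y | ProbabilityTheory.cdf ν y ≤ ProbabilityTheory.cdf ν p} := fun y hy => hmono hy
    rw [hD]
    dsimp only
    rw [measure_sdiff hsub measurableSet_Iic.nullMeasurableSet
      (measure_ne_top _ _), measure_preimage_cdf_Iic ν hc (ProbabilityTheory.cdf_nonneg ν p)
        (ProbabilityTheory.cdf_le_one ν p), ProbabilityTheory.ofReal_cdf, tsub_self]
  refine ⟨F, (⋃ p, D p)ᶜ, hmp, (MeasurableSet.iUnion hDm).compl, ?_, ?_⟩
  · rw [compl_compl]; exact measure_iUnion_null hD0
  -- Of two points of a flat piece of the distribution function, the larger lies in some `D p`.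
  have key : ∀ x y, x < y → F x = F y → y ∈ ⋃ p, D p := fun x y hxy h => by
    obtain ⟨p, hp1, hp2⟩ := exists_rat_btwn hxy
    refine Set.mem_iUnion.2 ⟨p, ?_, not_le.2 hp2⟩
    have : ProbabilityTheory.cdf ν x = ProbabilityTheory.cdf ν y := congrArg Subtype.val h
    exact this.symm.trans_le (hmono hp1.le)
  intro x hx y hy h
  rcases lt_trichotomy x y with hlt | heq | hlt
  · exact absurd (key x y hlt h) hy
  · exact heq
  · exact absurd (key y x hlt h.symm) hx

theorem exists_measurePreserving_unitInterval {X : Type*} [MeasurableSpace X] [StandardBorelSpace X]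
    (μ : Measure X) [IsProbabilityMeasure μ] [NullSingletonClass μ] :
    ∃ (F : X → unitInterval) (N : Set X), MeasurePreserving F μ volume ∧ MeasurableSet N ∧
      μ Nᶜ = 0 ∧ Set.InjOn F N := by
  have he := measurableEmbedding_embeddingReal X
  have hp := Measure.isProbabilityMeasure_map (μ := μ) he.measurable.aemeasurable
  have : NullSingletonClass (μ.map (embeddingReal X)) := ⟨fun x => by
    rw [he.map_apply]
    exact Set.Subsingleton.measure_zero (fun a ha b hb => he.injective (ha.trans hb.symm)) μ⟩
  obtain ⟨F, N, hF, hN, hN0, hinj⟩ :=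
    exists_measurePreserving_unitInterval_of_real (μ.map (embeddingReal X))
  refine ⟨F ∘ embeddingReal X, embeddingReal X ⁻¹' N, hF.comp ⟨he.measurable, rfl⟩,
    he.measurable hN, ?_, hinj.comp he.injective.injOn fun x hx => hx⟩
  rwa [he.map_apply] at hN0

/-! ### Transport of an action along an almost everywhere isomorphism -/

namespace MPAction

section Factor

variable {G : Type*} [AddGroup G] {X Y Z : Type*} [MeasurableSpace X] [MeasurableSpace Y]
  [MeasurableSpace Z] {μ : Measure X} {ν : Measure Y} {ρ : Measure Z}

theorem IsFactorMap.comp {T : MPAction G μ} {S : MPAction G ν} {R : MPAction G ρ}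
    {φ : X → Y} {ψ : Y → Z} (hψ : IsFactorMap S R ψ) (hφ : IsFactorMap T S φ) :
    IsFactorMap T R (ψ ∘ φ) := by
  refine ⟨hψ.1.comp hφ.1, ?_⟩
  filter_upwards [hφ.2, hφ.1.quasiMeasurePreserving.ae hψ.2] with x hx hx' g
  simp only [Function.comp_apply]
  rw [hx, hx']

theorem IsFactorMap.cyclic {T : MPAction G μ} {S : MPAction G ν} {φ : X → Y}
    (hφ : IsFactorMap T S φ) (g : G) : IsFactorMap (T.cyclic g) (S.cyclic g) φ :=
  ⟨hφ.1, hφ.2.mono fun _ hx n => hx (n • g)⟩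

theorem act_neg_act (T : MPAction G μ) (g : G) (x : X) : T.act (-g) (T.act g x) = x := by
  rw [← T.act_add, neg_add_cancel, T.act_zero]

theorem act_act_neg (T : MPAction G μ) (g : G) (x : X) : T.act g (T.act (-g) x) = x := by
  rw [← T.act_add, add_neg_cancel, T.act_zero]

theorem image_act_eq_preimage (T : MPAction G μ) (g : G) (B : Set X) :
    T.act g '' B = T.act (-g) ⁻¹' B :=
  congrFun (Set.image_eq_preimage_of_inverse (T.act_neg_act g) (T.act_act_neg g)) B

theorem measurableSet_image_act (T : MPAction G μ) (g : G) {B : Set X} (hB : MeasurableSet B) :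
    MeasurableSet (T.act g '' B) := by
  rw [image_act_eq_preimage]
  exact (T.measurePreserving _).measurable hB

/-- A conull set contains an invariant conull set, when the group is countable. -/
theorem exists_invariant_conull [Countable G] (T : MPAction G μ) {N : Set X}
    (hN : MeasurableSet N) (h0 : μ Nᶜ = 0) :
    ∃ S ⊆ N, MeasurableSet S ∧ μ Sᶜ = 0 ∧ ∀ g, ∀ x ∈ S, T.act g x ∈ S := by
  refine ⟨⋂ g, T.act g ⁻¹' N, fun x hx => ?_,
    MeasurableSet.iInter fun g => (T.measurePreserving g).measurable hN, ?_, fun g x hx => ?_⟩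
  · simpa [T.act_zero] using Set.mem_iInter.1 hx 0
  · rw [Set.compl_iInter]
    refine measure_iUnion_null fun g => ?_
    rw [← Set.preimage_compl]
    exact (T.measurePreserving g).quasiMeasurePreserving.preimage_null h0
  · refine Set.mem_iInter.2 fun h => ?_
    rw [Set.mem_preimage, ← T.act_add]
    exact Set.mem_iInter.1 hx (h + g)

end Factor

section Transport

variable {G : Type*} [AddGroup G] {X Y : Type*} [MeasurableSpace X] [MeasurableSpace Y]
  {μ : Measure X} {ν : Measure Y}

open Classical in
/-- The action on `Y` which is the image of `T` under the injection `F` of the invariant conull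
set `S`, and which fixes the points outside `F '' S`. -/
noncomputable def transport (T : MPAction G μ) {F : X → Y} {S : Set X}
    (hF : MeasurePreserving F μ ν) (he : MeasurableEmbedding (S.domRestrict F)) (h0 : μ Sᶜ = 0)
    (hS : ∀ g, ∀ x ∈ S, T.act g x ∈ S) : MPAction G ν where
  act g := Function.extend (S.domRestrict F) (fun x => F (T.act g x)) id
  measurePreserving g := by
    have hm : Measurable (Function.extend (S.domRestrict F) (fun x : S => F (T.act g x)) id) :=
      he.measurable_extend
        (hF.measurable.comp ((T.measurePreserving g).measurable.comp measurable_subtype_coe))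
        measurable_id
    refine ⟨hm, ?_⟩
    have hae : Function.extend (S.domRestrict F) (fun x : S => F (T.act g x)) id ∘ F =ᵐ[μ]
        F ∘ T.act g := by
      filter_upwards [show ∀ᵐ x ∂μ, x ∈ S from h0] with x hx
      exact he.injective.extend_apply _ _ ⟨x, hx⟩
    conv_lhs => rw [← hF.map_eq]
    rw [Measure.map_map hm hF.measurable, Measure.map_congr hae]
    exact (hF.comp (T.measurePreserving g)).map_eq
  act_zero y := by
    by_cases hy : ∃ x, S.domRestrict F x = y
    · obtain ⟨x, rfl⟩ := hy
      rw [he.injective.extend_apply, T.act_zero]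
      rfl
    · rw [Function.extend_apply' _ _ _ hy]
      rfl
  act_add g h y := by
    by_cases hy : ∃ x, S.domRestrict F x = y
    · obtain ⟨x, rfl⟩ := hy
      rw [he.injective.extend_apply, he.injective.extend_apply, T.act_add]
      exact (he.injective.extend_apply (fun x : S => F (T.act g x)) id
        ⟨T.act h x, hS h x x.2⟩).symm
    · rw [Function.extend_apply' _ _ _ hy, Function.extend_apply' _ _ _ hy]
      exact (Function.extend_apply' _ _ _ hy).symm

variable {T : MPAction G μ} {F : X → Y} {S : Set X}
    (hF : MeasurePreserving F μ ν) (he : MeasurableEmbedding (S.domRestrict F)) (h0 : μ Sᶜ = 0)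
    (hS : ∀ g, ∀ x ∈ S, T.act g x ∈ S)

theorem transport_act (g : G) {x : X} (hx : x ∈ S) :
    (T.transport hF he h0 hS).act g (F x) = F (T.act g x) :=
  he.injective.extend_apply (fun x : S => F (T.act g x)) id (⟨x, hx⟩ : S)

theorem isFactorMap_transport : IsFactorMap T (T.transport hF he h0 hS) F := by
  refine ⟨hF, ?_⟩
  filter_upwards [show ∀ᵐ x ∂μ, x ∈ S from h0] with x hx g
  exact (transport_act hF he h0 hS g hx).symm

theorem exists_isFactorMap_of_transport [Nonempty X] :
    ∃ ψ : Y → X, IsFactorMap (T.transport hF he h0 hS) T ψ := by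
  obtain ⟨ψ, hψ, hψF⟩ := he.exists_measurable_extend measurable_subtype_coe fun _ => ‹Nonempty X›
  have hψ' : ∀ x ∈ S, ψ (F x) = x := fun x hx => congrFun hψF ⟨x, hx⟩
  refine ⟨ψ, ⟨hψ, ?_⟩, ?_⟩
  · conv_lhs => rw [← hF.map_eq]
    rw [Measure.map_map hψ hF.measurable]
    have : ψ ∘ F =ᵐ[μ] id := by
      filter_upwards [show ∀ᵐ x ∂μ, x ∈ S from h0] with x hx using hψ' x hx
    rw [Measure.map_congr this, Measure.map_id]
  · have hr : MeasurableSet (Set.range (S.domRestrict F)) := he.measurableSet_range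
    have : ∀ᵐ y ∂ν, y ∈ Set.range (S.domRestrict F) := by
      rw [← hF.map_eq]
      refine (ae_map_iff hF.aemeasurable hr).2 ?_
      filter_upwards [show ∀ᵐ x ∂μ, x ∈ S from h0] with x hx using ⟨⟨x, hx⟩, rfl⟩
    filter_upwards [this] with y hy g
    obtain ⟨⟨x, hx⟩, rfl⟩ := hy
    rw [Set.domRestrict_apply, transport_act hF he h0 hS g hx, hψ' _ hx, hψ' _ (hS g x hx)]

theorem isRankOneFor_transport {R : ℕ → Finset G} (hT : T.IsRankOneFor R) :
    (T.transport hF he h0 hS).IsRankOneFor R := by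
  obtain ⟨hne, B, hB, hA⟩ := hT
  have hinj : Set.InjOn F S := Set.injOn_iff_injective.2 he.injective
  have himage : ∀ C : Set X, F '' (C ∩ S) = S.domRestrict F '' (Subtype.val ⁻¹' C) := fun C => by
    rw [Set.domRestrict_eq, Set.image_comp, Subtype.image_preimage_coe, Set.inter_comm]
  have hmeas : ∀ C : Set X, MeasurableSet C → MeasurableSet (F '' (C ∩ S)) := fun C hC => by
    rw [himage]
    exact he.measurableSet_image.2 (measurable_subtype_coe hC)
  have hlevel : ∀ n v, (T.transport hF he h0 hS).act v '' (F '' (B n ∩ S)) =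
      F '' (T.act v '' B n ∩ S) := fun n v => by
    ext y
    constructor
    · rintro ⟨_, ⟨x, ⟨hx, hxS⟩, rfl⟩, rfl⟩
      exact ⟨T.act v x, ⟨⟨x, hx, rfl⟩, hS v x hxS⟩, (transport_act hF he h0 hS v hxS).symm⟩
    · rintro ⟨_, ⟨⟨x, hx, rfl⟩, hxS⟩, rfl⟩
      have hx' : x ∈ S := by simpa [T.act_neg_act] using hS (-v) _ hxS
      exact ⟨F x, ⟨x, ⟨hx, hx'⟩, rfl⟩, transport_act hF he h0 hS v hx'⟩
  refine ⟨hne, fun n => F '' (B n ∩ S), fun n => ⟨hmeas _ (hB n).1, ?_, ?_⟩, fun A hAm => ?_⟩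
  · rw [← hF.measure_preimage (hmeas _ (hB n).1).nullMeasurableSet]
    refine lt_of_lt_of_le (hB n).2.1 ?_
    rw [← measure_inter_conull h0]
    exact measure_mono (Set.subset_preimage_image _ _)
  · intro v hv w hw hvw
    rw [hlevel, hlevel]
    refine Set.disjoint_image_image fun x hx y hy hxy => ?_
    have := hinj hx.2 hy.2 hxy
    subst this
    exact Set.disjoint_left.1 ((hB n).2.2 v hv w hw hvw) hx.1 hy.1
  · obtain ⟨L, hL, hlim⟩ := hA (F ⁻¹' A) (hF.measurable hAm)
    refine ⟨L, hL, tendsto_of_tendsto_of_tendsto_of_le_of_le tendsto_const_nhds hlim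
      (fun _ => zero_le) fun n => ?_⟩
    have hm : MeasurableSet (symmDiff
        (⋃ v ∈ L n, (T.transport hF he h0 hS).act v '' (F '' (B n ∩ S))) A) := by
      refine MeasurableSet.symmDiff (Finset.measurableSet_biUnion _ fun v _ => ?_) hAm
      rw [hlevel]
      exact hmeas _ (T.measurableSet_image_act v (hB n).1)
    dsimp only
    rw [← hF.measure_preimage hm.nullMeasurableSet]
    refine measure_mono_ae ?_
    filter_upwards [show ∀ᵐ x ∂μ, x ∈ S from h0] with x hx hxd
    have key : F x ∈ (⋃ v ∈ L n, (T.transport hF he h0 hS).act v '' (F '' (B n ∩ S))) ↔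
        x ∈ ⋃ v ∈ L n, T.act v '' B n := by
      simp only [Set.mem_iUnion, hlevel]
      refine exists_congr fun v => exists_congr fun _ => ⟨?_, fun h => ⟨x, ⟨h, hx⟩, rfl⟩⟩
      rintro ⟨x', ⟨h, hx'⟩, hxx⟩
      rwa [← hinj hx' hx hxx]
    have hxd' : F x ∈ symmDiff
        (⋃ v ∈ L n, (T.transport hF he h0 hS).act v '' (F '' (B n ∩ S))) A := hxd
    rw [Set.mem_symmDiff, key] at hxd'
    exact Set.mem_symmDiff.2 hxd'

end Transport

end MPAction

/-! ### Odometers -/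

namespace FiniteIndexChain

variable {A : Type*} [AddCommGroup A] (𝔊 : FiniteIndexChain A)

theorem diag_add (v w : A) : 𝔊.diag (v + w) = 𝔊.diag v + 𝔊.diag w := rfl

theorem diag_zero : 𝔊.diag 0 = 0 := rfl

theorem coord_diag (j : ℕ) (v : A) : 𝔊.coord j (𝔊.diag v) = (v : A ⧸ 𝔊.grp j) := rfl

theorem ext_coord {x y : 𝔊.Space} (h : ∀ j, 𝔊.coord j x = 𝔊.coord j y) : x = y :=
  Subtype.ext (funext h)

theorem diag_eq_zero {v : A} (h : ∀ j, v ∈ 𝔊.grp j) : 𝔊.diag v = 0 :=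
  𝔊.ext_coord fun j => by
    rw [coord_diag, map_zero]
    exact (QuotientAddGroup.eq_zero_iff v).2 (h j)

instance : IsProbabilityMeasure 𝔊.haar := ⟨Measure.addHaarMeasure_self⟩

instance : 𝔊.haar.IsAddHaarMeasure := inferInstanceAs (Measure.addHaarMeasure ⊤).IsAddHaarMeasure

instance : SecondCountableTopology 𝔊.Space :=
  ⟨⟨𝔊.cylinders, 𝔊.countable_cylinders, 𝔊.topology_eq⟩⟩

theorem isClopen_coord_preimage (j : ℕ) (s : Set (A ⧸ 𝔊.grp j)) :
    IsClopen (𝔊.coord j ⁻¹' s) := by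
  have h : ∀ t : Set (A ⧸ 𝔊.grp j), IsOpen (𝔊.coord j ⁻¹' t) := fun t => by
    have hle : TopologicalSpace.induced (𝔊.coord j) ⊥ ≥
        (inferInstance : TopologicalSpace 𝔊.Space) := iInf_le _ j
    exact hle _ ⟨t, trivial, rfl⟩
  exact ⟨⟨h sᶜ⟩, h s⟩

instance : T2Space 𝔊.Space := by
  refine ⟨fun x y hne => ?_⟩
  obtain ⟨j, hj⟩ : ∃ j, 𝔊.coord j x ≠ 𝔊.coord j y := by
    by_contra! h
    exact hne (𝔊.ext_coord h)
  exact ⟨_, _, (𝔊.isClopen_coord_preimage j {𝔊.coord j x}).2,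
    (𝔊.isClopen_coord_preimage j {𝔊.coord j y}).2, rfl, rfl,
    (Set.disjoint_singleton.2 hj).preimage _⟩

instance : PolishSpace 𝔊.Space := by
  let := TopologicalSpace.metrizableSpaceMetric 𝔊.Space
  exact { }

end FiniteIndexChain

/-- An element lying in every group of the chain acts trivially on an odometer, so it vanishes if
the odometer is free. -/
theorem MPAction.IsFree.eq_zero_of_isConjugate_odometer {A : Type*} [AddCommGroup A]
    {𝔊 : FiniteIndexChain A} {Y : Type*} [MeasurableSpace Y] {ν : Measure Y}
    [NeZero ν] {S : MPAction A ν} (hfree : S.IsFree)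
    (hconj : S.IsConjugate 𝔊.odometer) {g : A} (hg : ∀ j, g ∈ 𝔊.grp j) : g = 0 := by
  obtain ⟨ψ, ⟨-, hψ⟩, N, hN, hinj⟩ := hconj
  have hN' : ∀ᵐ y ∂ν, y ∈ N := hN
  obtain ⟨y, hy, hy1, hy2, hfy⟩ := (hψ.and (hN'.and
    (((S.measurePreserving g).quasiMeasurePreserving.ae hN').and hfree))).exists
  refine hfy g (hinj hy2 hy1 ?_)
  rw [hy g]
  change 𝔊.diag g + ψ y = ψ y
  rw [𝔊.diag_eq_zero hg, zero_add]

instance : IsProbabilityMeasure (volume : Measure UnitAddCircle) := ⟨UnitAddCircle.measure_univ⟩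

instance : NullSingletonClass (volume : Measure UnitAddCircle) := ⟨fun x => by
  rw [← Metric.closedBall_zero, AddCircle.volume_closedBall]
  simp⟩

/-! ### The action on the product of the dyadic odometer and the circle -/

/-- The product of the dyadic integers and the circle, with Haar measure. -/
abbrev DyadicCircle : Type := dyadicChain.Space × UnitAddCircle

instance : NullSingletonClass (dyadicChain.haar.prod (volume : Measure UnitAddCircle)) :=
  Measure.prod.instNullSingletonClass_snd

/-- The action of `ℤ²` on the product of the dyadic integers and the circle in which `(a, b)` adds
`a + b` in the first coordinate and `a * α` in the second one. -/
noncomputable def dyadicCircleAction (α : ℝ) : MPAction (Fin 2 → ℤ)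
    (dyadicChain.haar.prod (volume : Measure UnitAddCircle)) where
  act g p := (dyadicChain.diag (g 0 + g 1) + p.1, g 0 • (α : UnitAddCircle) + p.2)
  measurePreserving g :=
    (measurePreserving_add_left dyadicChain.haar _).prod (measurePreserving_add_left volume _)
  act_zero p := by simp [FiniteIndexChain.diag_zero]
  act_add g h p := by
    have : (g + h) 0 + (g + h) 1 = (g 0 + g 1) + (h 0 + h 1) := by
      simp only [Pi.add_apply]; ring
    rw [this, FiniteIndexChain.diag_add, Pi.add_apply, add_zsmul, add_assoc, add_assoc]

theorem isFactorMap_fst_dyadicCircleAction (α : ℝ) (i : Fin 2) :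
    MPAction.IsFactorMap ((dyadicCircleAction α).cyclic (Pi.single i 1)) dyadicOdometer
      (Prod.fst : DyadicCircle → dyadicChain.Space) := by
  refine ⟨measurePreserving_fst, Eventually.of_forall fun p n => ?_⟩
  change dyadicChain.diag ((n • (Pi.single i 1 : Fin 2 → ℤ)) 0 +
    (n • (Pi.single i 1 : Fin 2 → ℤ)) 1) + p.1 = dyadicChain.diag n + p.1
  congr 2
  fin_cases i <;> simp

theorem addOrderOf_zsmul_coe_eq_zero {α : ℝ} (hα : Irrational α) {n : ℤ} (hn : n ≠ 0) :
    addOrderOf (n • (α : UnitAddCircle)) = 0 := by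
  rw [← AddCircle.coe_zsmul, ← AddCircle.denseRange_zsmul_iff, AddCircle.denseRange_zsmul_coe_iff,
    div_one, zsmul_eq_mul]
  exact hα.intCast_mul hn

/-- A set invariant under `id × R`, where `R` is a rotation by a nonzero multiple of `α`, is also
invariant under `id × R_α`: its sections are null or conull, as irrational rotations are ergodic. -/
theorem ae_mem_iff_of_ae_mem_iff_zsmul {Z : Type*} [MeasurableSpace Z] {ρ : Measure Z} [SFinite ρ]
    {α : ℝ} (hα : Irrational α) {n : ℤ} (hn : n ≠ 0) {E : Set (Z × UnitAddCircle)}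
    (hE : MeasurableSet E)
    (h : ∀ᵐ p ∂(ρ.prod volume), (p.1, n • (α : UnitAddCircle) + p.2) ∈ E ↔ p ∈ E) :
    ∀ᵐ p ∂(ρ.prod (volume : Measure UnitAddCircle)),
      (p.1, (α : UnitAddCircle) + p.2) ∈ E ↔ p ∈ E := by
  have hm : ∀ c : UnitAddCircle, MeasurableSet
      {p : Z × UnitAddCircle | (p.1, c + p.2) ∈ E ↔ p ∈ E} := fun c =>
    MeasurableSet.iff ((measurable_fst.prodMk (measurable_const.add measurable_snd)) hE) hE
  rw [Measure.ae_prod_iff_ae_ae (hm _)] at h ⊢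
  filter_upwards [h] with z hz
  have herg : Ergodic (n • (α : UnitAddCircle) + ·) volume :=
    AddCircle.ergodic_add_left.2 (addOrderOf_zsmul_coe_eq_zero hα hn)
  have hs : MeasurableSet (Prod.mk z ⁻¹' E) := measurable_prodMk_left hE
  have hconst := herg.quasiErgodic.ae_empty_or_univ₀ hs.nullMeasurableSet
    (by filter_upwards [hz] with w hw using propext hw)
  have hpres := (measurePreserving_add_left (volume : Measure UnitAddCircle)
    (α : UnitAddCircle)).quasiMeasurePreserving
  rcases hconst with h0 | h1
  · have h0' : ∀ᵐ w ∂(volume : Measure UnitAddCircle), (z, w) ∉ E := by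
      filter_upwards [h0] with w hw
      exact fun h => (hw.mp h : w ∈ (∅ : Set UnitAddCircle))
    filter_upwards [h0', hpres.ae h0'] with w hw hw'
    exact ⟨fun h => absurd h hw', fun h => absurd h hw⟩
  · have h1' : ∀ᵐ w ∂(volume : Measure UnitAddCircle), (z, w) ∈ E := by
      filter_upwards [h1] with w hw
      exact (hw.mpr trivial)
    filter_upwards [h1', hpres.ae h1'] with w hw hw'
    exact ⟨fun _ => hw, fun _ => hw'⟩

/-- Every odometer factor of the action has `(1, -1)` in all the groups of its chain. -/
theorem mem_grp_of_isFactorMap_dyadicCircleAction {α : ℝ} (hα : Irrational α)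
    {𝔊 : FiniteIndexChain (Fin 2 → ℤ)} {φ : DyadicCircle → 𝔊.Space}
    (hφ : MPAction.IsFactorMap (dyadicCircleAction α) 𝔊.odometer φ) (j : ℕ) :
    ![1, -1] ∈ 𝔊.grp j := by
  have := 𝔊.finiteIndex j
  set u : Fin 2 → ℤ := ![1, -1] with hu
  have hact : ∀ (n : ℤ) (p : DyadicCircle),
      (dyadicCircleAction α).act (n • u) p = (p.1, n • (α : UnitAddCircle) + p.2) := fun n p => by
    change (dyadicChain.diag ((n • u) 0 + (n • u) 1) + p.1,
      (n • u) 0 • (α : UnitAddCircle) + p.2) = _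
    have h0 : (n • u) 0 = n := by simp [hu]
    have h1 : (n • u) 1 = -n := by simp [hu]
    rw [h0, h1, add_neg_cancel, FiniteIndexChain.diag_zero, zero_add]
  have hcoord : ∀ᵐ p ∂(dyadicChain.haar.prod (volume : Measure UnitAddCircle)), ∀ n : ℤ,
      𝔊.coord j (φ (p.1, n • (α : UnitAddCircle) + p.2)) =
        ((n • u : Fin 2 → ℤ) : (Fin 2 → ℤ) ⧸ 𝔊.grp j) + 𝔊.coord j (φ p) := by
    filter_upwards [hφ.2] with p hp n
    rw [← hact, hp]
    exact map_add (𝔊.coord j) (𝔊.diag (n • u)) (φ p)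
  have hmeas : ∀ c, MeasurableSet {p : DyadicCircle | 𝔊.coord j (φ p) = c} := fun c =>
    hφ.1.measurable (𝔊.isClopen_coord_preimage j {c}).2.measurableSet
  -- The multiple `N • u` acts trivially on the finite quotient, so the `j`-th coordinate
  -- of `φ` is invariant under it.
  set N : ℤ := ((𝔊.grp j).index : ℤ) with hN
  have hN0 : N ≠ 0 := Int.natCast_ne_zero.2 AddSubgroup.FiniteIndex.index_ne_zero
  have hNu : ((N • u : Fin 2 → ℤ) : (Fin 2 → ℤ) ⧸ 𝔊.grp j) = 0 := by
    rw [QuotientAddGroup.eq_zero_iff, hN, natCast_zsmul]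
    exact AddSubgroup.nsmul_index_mem _ _
  have hinv : ∀ c, ∀ᵐ p ∂(dyadicChain.haar.prod (volume : Measure UnitAddCircle)),
      (𝔊.coord j (φ (p.1, (α : UnitAddCircle) + p.2)) = c ↔ 𝔊.coord j (φ p) = c) := fun c => by
    refine ae_mem_iff_of_ae_mem_iff_zsmul hα hN0 (hmeas c) ?_
    filter_upwards [hcoord] with p hp
    have := hp N
    rw [hNu, zero_add] at this
    change 𝔊.coord j (φ (p.1, N • (α : UnitAddCircle) + p.2)) = c ↔ 𝔊.coord j (φ p) = c
    rw [this]
  obtain ⟨p, hp, hp'⟩ := (hcoord.and (ae_all_iff.2 hinv)).exists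
  have h1 := (hp' (𝔊.coord j (φ p))).2 rfl
  have h2 := hp 1
  rw [one_zsmul, h1, one_zsmul] at h2
  exact (QuotientAddGroup.eq_zero_iff _).1 (right_eq_add.1 h2)

/-! ### Følner sequences of boxes -/

theorem card_Ico_sdiff_image_add_le (h : ℕ) (s : ℤ) :
    (Finset.Ico (0 : ℤ) h \ (Finset.Ico (0 : ℤ) h).image (· + s)).card ≤ s.natAbs := by
  calc _ ≤ (Finset.Ico 0 s ∪ Finset.Ico (h + s) h).card := by
        refine Finset.card_le_card fun x hx => ?_
        simp only [Finset.mem_sdiff, Finset.mem_image, Finset.mem_Ico, not_exists, not_and] at hx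
        have := hx.2 (x - s)
        simp only [Finset.mem_union, Finset.mem_Ico]
        omega
    _ ≤ (Finset.Ico 0 s).card + (Finset.Ico (h + s) (h : ℤ)).card := Finset.card_union_le _ _
    _ = s.natAbs := by simp only [Int.card_Ico]; omega

theorem card_box_sdiff_image_add_le (h k : ℕ) (w : ℤ × ℤ) :
    ((Finset.Ico (0 : ℤ) h ×ˢ Finset.Ico (0 : ℤ) k) \
      (Finset.Ico (0 : ℤ) h ×ˢ Finset.Ico (0 : ℤ) k).image (· + w)).card ≤
        w.1.natAbs * k + h * w.2.natAbs := by
  set I := Finset.Ico (0 : ℤ) h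
  set J := Finset.Ico (0 : ℤ) k
  have hI : I.card = h := by simp [I]
  have hJ : J.card = k := by simp [J]
  calc _ ≤ ((I \ I.image (· + w.1)) ×ˢ J ∪ I ×ˢ (J \ J.image (· + w.2))).card := by
        refine Finset.card_le_card fun x hx => ?_
        rw [Finset.mem_sdiff, Finset.mem_product] at hx
        by_contra hcon
        simp only [Finset.mem_union, Finset.mem_product, Finset.mem_sdiff, not_or, not_and,
          not_not] at hcon
        obtain ⟨a, ha, ha'⟩ := Finset.mem_image.1 (by_contra fun h =>
          hcon.1 ⟨hx.1.1, h⟩ hx.1.2 : x.1 ∈ I.image (· + w.1))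
        obtain ⟨b, hb, hb'⟩ := Finset.mem_image.1 (hcon.2 hx.1.1 hx.1.2)
        exact hx.2 (Finset.mem_image.2 ⟨(a, b), Finset.mk_mem_product ha hb, Prod.ext ha' hb'⟩)
    _ ≤ _ := Finset.card_union_le _ _
    _ = (I \ I.image (· + w.1)).card * k + h * (J \ J.image (· + w.2)).card := by
        rw [Finset.card_product, Finset.card_product, hI, hJ]
    _ ≤ _ := Nat.add_le_add (Nat.mul_le_mul_right _ (card_Ico_sdiff_image_add_le h w.1))
        (Nat.mul_le_mul_left _ (card_Ico_sdiff_image_add_le k w.2))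

theorem card_symmDiff_box_image_add_le (h k : ℕ) (w : ℤ × ℤ) :
    (symmDiff (Finset.Ico (0 : ℤ) h ×ˢ Finset.Ico (0 : ℤ) k)
      ((Finset.Ico (0 : ℤ) h ×ˢ Finset.Ico (0 : ℤ) k).image (· + w))).card ≤
        2 * (w.1.natAbs * k + h * w.2.natAbs) := by
  set P := Finset.Ico (0 : ℤ) h ×ˢ Finset.Ico (0 : ℤ) k
  have h1 : (P \ P.image (· + w)).card ≤ w.1.natAbs * k + h * w.2.natAbs := by
    convert card_box_sdiff_image_add_le h k w
  have h2 : (P.image (· + w) \ P).card ≤ w.1.natAbs * k + h * w.2.natAbs := by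
    have : P.image (· + w) \ P = (P \ P.image (· + -w)).image (· + w) := by
      rw [Finset.image_sdiff _ _ (add_left_injective w), Finset.image_image]
      congr 1
      simp [Function.comp_def]
    rw [this, Finset.card_image_of_injective _ (add_left_injective w)]
    have h3 := card_box_sdiff_image_add_le h k (-w)
    simp only [Prod.fst_neg, Prod.snd_neg, Int.natAbs_neg] at h3
    convert h3
  calc _ ≤ _ := Finset.card_union_le _ _
    _ ≤ _ := by
      change (P \ P.image (· + w)).card + (P.image (· + w) \ P).card ≤ _
      omega

theorem isFolnerSeq_box {h k : ℕ → ℕ} (h0 : ∀ n, 0 < h n) (k0 : ∀ n, 0 < k n)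
    (hh : Tendsto h atTop atTop) (hk : Tendsto k atTop atTop) :
    IsFolnerSeq fun n => Finset.Ico (0 : ℤ) (h n) ×ˢ Finset.Ico (0 : ℤ) (k n) := by
  refine ⟨fun n => ⟨(0, 0), by simp [h0 n, k0 n]⟩, fun w => ?_⟩
  have hlim : Tendsto (fun n => 2 * (w.1.natAbs / (h n : ℝ) + w.2.natAbs / (k n : ℝ)))
      atTop (𝓝 (2 * (0 + 0))) :=
    ((tendsto_const_nhds.div_atTop (tendsto_natCast_atTop_atTop.comp hh)).add
      (tendsto_const_nhds.div_atTop (tendsto_natCast_atTop_atTop.comp hk))).const_mul 2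
  rw [add_zero, mul_zero] at hlim
  refine squeeze_zero (fun n => by positivity) (fun n => ?_) hlim
  have hn : (0 : ℝ) < h n := Nat.cast_pos.2 (h0 n)
  have kn : (0 : ℝ) < k n := Nat.cast_pos.2 (k0 n)
  have hcard : ((Finset.Ico (0 : ℤ) (h n) ×ˢ Finset.Ico (0 : ℤ) (k n)).card : ℝ) =
      h n * k n := by simp
  rw [hcard, div_le_iff₀ (by positivity)]
  refine (Eq.le ?_).trans ((Nat.cast_le (α := ℝ).2
    (card_symmDiff_box_image_add_le (h n) (k n) w)).trans (Eq.le ?_))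
  · congr!
  push_cast
  field_simp

theorem IsFolnerSeq.map {G H : Type*} [AddGroup G] [AddGroup H]
    {F : ℕ → Finset G} (hF : IsFolnerSeq F) (e : G ≃+ H) :
    IsFolnerSeq fun n => (F n).map e.toEquiv.toEmbedding := by
  classical
  refine ⟨fun n => (hF.1 n).map, fun w => ?_⟩
  have key : ∀ n, (symmDiff ((F n).map e.toEquiv.toEmbedding)
      (((F n).map e.toEquiv.toEmbedding).image (· + w))).card =
        (symmDiff (F n) ((F n).image (· + e.symm w))).card := fun n => by
    have : ((F n).map e.toEquiv.toEmbedding).image (· + w) =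
        ((F n).image (· + e.symm w)).image e := by
      rw [Finset.map_eq_image, Finset.image_image, Finset.image_image]
      congr 1
      ext u
      simp
    rw [this, Finset.map_eq_image]
    refine Eq.trans ?_ (Finset.card_image_of_injective _ e.injective)
    rw [Finset.image_symmDiff _ _ e.injective]
    rfl
  refine (hF.2 (e.symm w)).congr fun n => ?_
  rw [Finset.card_map]
  exact congrArg (fun m : ℕ => (m : ℝ) / ((F n).card : ℝ)) (key n).symm

/-! ### A topological criterion for rank one -/

/-- Towers on a compact metrizable space whose levels shrink uniformly and whose unions exhaust the
space in measure make the action rank one. By regularity, a measurable set `A` lies between a closed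
set `K` and an open set `U` of almost the same measure, and the levels that meet `K` eventually
cover `K`, up to the complement of the tower, without leaving `U`. -/
theorem MPAction.isRankOneFor_of_shrinking {G : Type*} [AddGroup G] {X : Type*} [TopologicalSpace X]
    [CompactSpace X] [TopologicalSpace.PseudoMetrizableSpace X] [MeasurableSpace X] [BorelSpace X]
    {μ : Measure X} [IsFiniteMeasure μ] {T : MPAction G μ} {F : ℕ → Finset G} {B : ℕ → Set X}
    (hne : ∀ n, (F n).Nonempty) (hB : ∀ n, T.IsTowerBase (F n) (B n))
    (hcover : Tendsto (fun n => μ (⋃ v ∈ F n, T.act v '' B n)ᶜ) atTop (𝓝 0))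
    (hshrink : ∀ x, ∀ U ∈ 𝓝 x, ∃ W ∈ 𝓝 x, ∀ᶠ n in atTop, ∀ v ∈ F n,
      (T.act v '' B n ∩ W).Nonempty → T.act v '' B n ⊆ U) :
    T.IsRankOneFor F := by
  classical
  refine ⟨hne, B, hB, fun A hA => ?_⟩
  -- Among the finitely many unions of levels, take one that is closest to `A`.
  have hmin : ∀ n, ∃ L ∈ (F n).powerset, ∀ L' ∈ (F n).powerset,
      μ (symmDiff (⋃ v ∈ L, T.act v '' B n) A) ≤ μ (symmDiff (⋃ v ∈ L', T.act v '' B n) A) :=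
    fun n => Finset.exists_min_image _ _ ⟨∅, Finset.empty_mem_powerset _⟩
  choose L hL hLmin using hmin
  refine ⟨L, fun n => Finset.mem_powerset.1 (hL n), ?_⟩
  refine ENNReal.tendsto_nhds_zero.2 fun ε hε => ?_
  have hε4 : ε / 2 / 2 ≠ 0 := (ENNReal.half_pos (ENNReal.half_pos hε.ne').ne').ne'
  obtain ⟨K, hKA, hK, hKε⟩ := hA.exists_isClosed_sdiff_lt (measure_ne_top μ A) hε4
  obtain ⟨U, hAU, hU, -, hUε⟩ := hA.exists_isOpen_sdiff_lt (measure_ne_top μ A) hε4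
  have hev : ∀ᶠ n in atTop, ∀ v ∈ F n, (T.act v '' B n ∩ K).Nonempty → T.act v '' B n ⊆ U := by
    refine hK.isCompact.induction_on
      (p := fun K => ∀ᶠ n in atTop, ∀ v ∈ F n, (T.act v '' B n ∩ K).Nonempty → T.act v '' B n ⊆ U)
      ?_ ?_ ?_ ?_
    · simp
    · exact fun s t hst ht => ht.mono fun n hn v hv h => hn v hv (h.mono
        (Set.inter_subset_inter_right _ hst))
    · intro s t hs ht
      filter_upwards [hs, ht] with n hn hn' v hv h
      rw [Set.inter_union_distrib_left, Set.union_nonempty] at h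
      exact h.elim (hn v hv) (hn' v hv)
    · intro x hx
      obtain ⟨W, hW, h⟩ := hshrink x U (hU.mem_nhds (hAU (hKA hx)))
      exact ⟨W, mem_nhdsWithin_of_mem_nhds hW, h⟩
  filter_upwards [hev, ENNReal.tendsto_nhds_zero.1 hcover (ε / 2 / 2) (pos_iff_ne_zero.2 hε4)]
    with n hn hn'
  refine (hLmin n ((F n).filter fun v => (T.act v '' B n ∩ K).Nonempty)
    (Finset.mem_powerset.2 (Finset.filter_subset _ _))).trans ?_
  have hsub : symmDiff (⋃ v ∈ (F n).filter fun v => (T.act v '' B n ∩ K).Nonempty,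
      T.act v '' B n) A ⊆ (U \ A) ∪ (A \ K) ∪ (⋃ v ∈ F n, T.act v '' B n)ᶜ := by
    rintro x (⟨hx, hxA⟩ | ⟨hxA, hx⟩)
    · obtain ⟨v, hv, hxv⟩ := Set.mem_iUnion₂.1 hx
      rw [Finset.mem_filter] at hv
      exact Or.inl (Or.inl ⟨hn v hv.1 hv.2 hxv, hxA⟩)
    · by_cases hxK : x ∈ K
      · refine Or.inr fun hx' => hx ?_
        obtain ⟨v, hv, hxv⟩ := Set.mem_iUnion₂.1 hx'
        exact Set.mem_iUnion₂.2 ⟨v, Finset.mem_filter.2 ⟨hv, x, hxv, hxK⟩, hxv⟩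
      · exact Or.inl (Or.inr ⟨hxA, hxK⟩)
  calc _ ≤ _ := measure_mono hsub
    _ ≤ μ (U \ A) + μ (A \ K) + μ (⋃ v ∈ F n, T.act v '' B n)ᶜ :=
      (measure_union_le _ _).trans (add_le_add_left (measure_union_le _ _) _)
    _ ≤ ε / 2 / 2 + ε / 2 / 2 + (ε / 2 / 2 + ε / 2 / 2) :=
      add_le_add (add_le_add hUε.le hKε.le) (hn'.trans le_self_add)
    _ = ε := by
      rw [ENNReal.add_halves, ENNReal.add_halves]

/-! ### Towers for well approximable rotations -/

/-- A Liouville number has rational approximations, with large denominators, that are much better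
than the square of the denominator demands. -/
theorem Liouville.exists_rat_abs_sub_lt {α : ℝ} (hα : Liouville α) (n : ℕ) :
    ∃ r : ℚ, n < r.den ∧ |α - r| < 1 / ((n + 2) * (r.den : ℝ) ^ 2) := by
  obtain ⟨ε, hε, hε0⟩ := ((hα.irrational.eventually_forall_le_dist_cast_rat_of_den_le n).filter_mono
    nhdsWithin_le_nhds |>.and (self_mem_nhdsWithin (s := Set.Ioi (0 : ℝ)))).exists
  -- No rational with denominator at most `n` is within `ε` of `α`, so approximations better than
  -- `2⁻ᵐ < ε` have a large denominator.
  obtain ⟨m, hm⟩ := exists_pow_lt_of_lt_one hε0 (by norm_num : (1 / 2 : ℝ) < 1)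
  obtain ⟨a, b, hb, -, hab⟩ := hα (m + n + 4)
  have hb' : (b : ℝ) ≠ 0 := by exact_mod_cast (by omega : b ≠ 0)
  set r : ℚ := a / b with hr
  have hrR : (r : ℝ) = a / b := by rw [hr]; push_cast; rfl
  have hden : (r.den : ℤ) ∣ b := by rw [hr, ← Rat.divInt_eq_div]; exact Rat.den_dvd a b
  have hdenb : (r.den : ℝ) ≤ b := by exact_mod_cast Int.le_of_dvd (by omega) hden
  have hb2 : (2 : ℝ) ≤ b := by exact_mod_cast hb
  have hd0 : (0 : ℝ) < r.den := by exact_mod_cast r.den_pos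
  rw [← hrR] at hab
  refine ⟨r, ?_, hab.trans_le ?_⟩
  · by_contra! hle
    have h1 := hε r hle
    rw [Real.dist_eq] at h1
    have h2 : 1 / (b : ℝ) ^ (m + n + 4) ≤ (1 / 2) ^ m := by
      rw [one_div_pow]
      refine one_div_le_one_div_of_le (by positivity) ?_
      calc (2 : ℝ) ^ m ≤ (b : ℝ) ^ m := pow_le_pow_left₀ (by norm_num) hb2 m
        _ ≤ (b : ℝ) ^ (m + n + 4) := pow_le_pow_right₀ (by linarith) (by omega)
    linarith
  · refine one_div_le_one_div_of_le (by positivity) ?_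
    have hn : (n + 2 : ℝ) ≤ (b : ℝ) ^ (n + 2) := by
      calc (n + 2 : ℝ) ≤ (2 : ℝ) ^ (n + 2) := by
            exact_mod_cast (Nat.lt_two_pow_self (n := n + 2)).le
        _ ≤ _ := pow_le_pow_left₀ (by norm_num) hb2 _
    calc (n + 2) * (r.den : ℝ) ^ 2 ≤ (b : ℝ) ^ (n + 2) * (b : ℝ) ^ 2 := by gcongr
      _ = (b : ℝ) ^ (n + 4) := by ring
      _ ≤ (b : ℝ) ^ (m + n + 4) := pow_le_pow_right₀ (by linarith) (by omega)

/-- If `α` is close to the fraction `r` with denominator `q`, the first `q` multiples of `α` on the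
circle are almost as well separated as the multiples of `1 / q`. -/
theorem lt_norm_zsmul_coe {α δ : ℝ} {r : ℚ} (hδ : |α - r| < δ / (r.den : ℝ) ^ 2)
    {m : ℤ} (hm : m ≠ 0) (hmq : |m| < r.den) :
    (1 - δ) / r.den < ‖m • (α : UnitAddCircle)‖ := by
  have hd0 : (0 : ℝ) < r.den := by exact_mod_cast r.den_pos
  rw [← AddCircle.coe_zsmul, UnitAddCircle.norm_eq, zsmul_eq_mul]
  set k := round ((m : ℝ) * α)
  have hnum : m * r.num - k * r.den ≠ 0 := fun h => by
    have hdvd : (r.den : ℤ) ∣ m * r.num := ⟨k, by linarith⟩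
    have hcop : IsCoprime (r.den : ℤ) r.num :=
      (Int.isCoprime_iff_nat_coprime.2 (by simpa using r.reduced.symm))
    have := Int.le_of_dvd (abs_pos.2 hm) ((dvd_abs _ _).2 (hcop.dvd_of_dvd_mul_right hdvd))
    omega
  have h1 : (1 : ℝ) ≤ |(m * r.num - k * r.den : ℝ)| := by exact_mod_cast Int.one_le_abs hnum
  have hr : (r : ℝ) = r.num / r.den := Rat.cast_def r
  have h2 : 1 / (r.den : ℝ) ≤ |m * (r : ℝ) - k| := by
    have : m * (r : ℝ) - k = (m * r.num - k * r.den) / r.den := by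
      rw [hr]; field_simp
    rw [this, abs_div, abs_of_pos hd0]
    gcongr
  have h3 : |(m : ℝ) * (α - r)| < δ / r.den := by
    have hm1 : (|m| : ℝ) ≤ r.den := by exact_mod_cast hmq.le
    have hm0 : (0 : ℝ) < |(m : ℝ)| := abs_pos.2 (by exact_mod_cast hm)
    calc |(m : ℝ) * (α - r)| = |(m : ℝ)| * |α - r| := abs_mul _ _
      _ < |(m : ℝ)| * (δ / (r.den : ℝ) ^ 2) := by gcongr
      _ ≤ r.den * (δ / (r.den : ℝ) ^ 2) := by
        refine mul_le_mul_of_nonneg_right hm1 ((abs_nonneg _).trans hδ.le)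
      _ = δ / r.den := by field_simp
  have h4 : m * (r : ℝ) - k = (m * α - k) - m * (α - r) := by ring
  have h5 := abs_sub (m * α - k) (m * (α - r))
  rw [← h4] at h5
  rw [sub_div]
  linarith

/-- The closed arc of radius `ρ` around `j * α` on the circle. -/
def arc (α ρ : ℝ) (j : ℤ) : Set UnitAddCircle := Metric.closedBall (j • (α : UnitAddCircle)) ρ

theorem disjoint_arc {α δ : ℝ} {r : ℚ} (hδ : |α - r| < δ / (r.den : ℝ) ^ 2) {i j : ℤ}
    (hi : i ∈ Finset.Ico (0 : ℤ) r.den) (hj : j ∈ Finset.Ico (0 : ℤ) r.den) (hij : i ≠ j) :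
    Disjoint (arc α ((1 - δ) / (2 * r.den)) i) (arc α ((1 - δ) / (2 * r.den)) j) := by
  rw [Finset.mem_Ico] at hi hj
  refine Metric.closedBall_disjoint_closedBall ?_
  rw [dist_eq_norm, ← sub_smul]
  refine lt_of_eq_of_lt ?_ (lt_norm_zsmul_coe hδ (sub_ne_zero.2 hij)
    (abs_lt.2 ⟨by linarith, by linarith⟩))
  field_simp
  ring

theorem volume_compl_iUnion_arc {α δ : ℝ} (hδ0 : 0 ≤ δ) (hδ1 : δ ≤ 1) {r : ℚ}
    (hδ : |α - r| < δ / (r.den : ℝ) ^ 2) :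
    volume (⋃ j ∈ Finset.Ico (0 : ℤ) r.den, arc α ((1 - δ) / (2 * r.den)) j)ᶜ =
      ENNReal.ofReal δ := by
  have hd0 : (1 : ℝ) ≤ r.den := by exact_mod_cast r.den_pos
  have hvol : ∀ j, volume (arc α ((1 - δ) / (2 * r.den)) j) = ENNReal.ofReal ((1 - δ) / r.den) := by
    intro j
    rw [arc, AddCircle.volume_closedBall, min_eq_right]
    · congr 1; field_simp
    · rw [mul_div_assoc', mul_div_mul_left _ _ two_ne_zero, div_le_one (by linarith)]
      linarith
  have hm : ∀ j, MeasurableSet (arc α ((1 - δ) / (2 * r.den)) j) := fun j =>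
    Metric.isClosed_closedBall.measurableSet
  rw [prob_compl_eq_one_sub (Finset.measurableSet_biUnion _ fun j _ => hm j),
    measure_biUnion_finset (fun i hi j hj hij => disjoint_arc hδ hi hj hij) (fun j _ => hm j)]
  simp only [hvol, Finset.sum_const, Int.card_Ico, sub_zero, Int.toNat_natCast]
  rw [nsmul_eq_mul, ← ENNReal.ofReal_natCast, ← ENNReal.ofReal_mul (by positivity),
    mul_div_cancel₀ _ (by linarith), ← ENNReal.ofReal_one, ← ENNReal.ofReal_sub _ (by linarith)]
  congr 1; ring

/-! ### The action has rank one -/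

namespace FiniteIndexChain

variable {A : Type*} [AddCommGroup A] (𝔊 : FiniteIndexChain A)

theorem coord_eq_of_le {i j : ℕ} (hij : i ≤ j) {x z : 𝔊.Space}
    (h : 𝔊.coord j x = 𝔊.coord j z) : 𝔊.coord i x = 𝔊.coord i z := by
  induction hij with
  | refl => exact h
  | @step m _ ih =>
    have hproj : ∀ y : 𝔊.Space, 𝔊.proj m (𝔊.coord (m + 1) y) = 𝔊.coord m y := fun y => y.2 m
    exact ih (by rw [← hproj x, ← hproj z, h])

/-- The cylinders around a point form a neighbourhood basis. -/
theorem exists_coord_preimage_subset {z : 𝔊.Space} {U : Set 𝔊.Space} (hU : U ∈ 𝓝 z) :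
    ∃ j, ∀ x, 𝔊.coord j x = 𝔊.coord j z → x ∈ U := by
  have hnhds : 𝓝 z = ⨅ j, 𝓟 (𝔊.coord j ⁻¹' {𝔊.coord j z}) := by
    rw [show 𝓝 z = @nhds 𝔊.Space (⨅ j, TopologicalSpace.induced (𝔊.coord j) ⊥) z from rfl,
      nhds_iInf]
    refine iInf_congr fun j => ?_
    let : TopologicalSpace (A ⧸ 𝔊.grp j) := ⊥
    have : DiscreteTopology (A ⧸ 𝔊.grp j) := ⟨rfl⟩
    rw [@nhds_induced _ _ ⊥, nhds_discrete, Filter.comap_pure]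
  rw [hnhds] at hU
  obtain ⟨j, -, hj⟩ := (hasBasis_iInf_principal (directed_of_isDirected_le
    fun i j hij x (hx : 𝔊.coord j x = 𝔊.coord j z) => 𝔊.coord_eq_of_le hij hx)).mem_iff.1 hU
  exact ⟨j, fun x hx => hj hx⟩

end FiniteIndexChain

/-- The coordinates on `ℤ²` in which the action is the product of the dyadic odometer and of the
rotation by `α`: the basis vectors are `(0, 1)` and `(1, -1)`. -/
def shearEquiv : ℤ × ℤ ≃+ (Fin 2 → ℤ) where
  toFun p := ![p.2, p.1 - p.2]
  invFun v := (v 0 + v 1, v 0)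
  left_inv p := by simp
  right_inv v := by ext i; fin_cases i <;> simp
  map_add' p q := by ext i; fin_cases i <;> simp; ring

theorem dyadicCircleAction_shearEquiv (α : ℝ) (i j : ℤ) (p : DyadicCircle) :
    (dyadicCircleAction α).act (shearEquiv (i, j)) p =
      (dyadicChain.diag i + p.1, j • (α : UnitAddCircle) + p.2) := by
  change (dyadicChain.diag (j + (i - j)) + p.1, j • (α : UnitAddCircle) + p.2) = _
  rw [add_sub_cancel]

/-- The base of the `n`-th tower: a dyadic cylinder times an arc. -/
def towerBase (n : ℕ) (ρ : ℝ) : Set DyadicCircle :=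
  (dyadicChain.coord n ⁻¹' {0}) ×ˢ Metric.closedBall 0 ρ

theorem image_towerBase (α : ℝ) (n : ℕ) (ρ : ℝ) (i j : ℤ) :
    (dyadicCircleAction α).act (shearEquiv (i, j)) '' towerBase n ρ =
      (dyadicChain.coord n ⁻¹' {(i : ℤ ⧸ dyadicChain.grp n)}) ×ˢ arc α ρ j := by
  ext p
  rw [MPAction.image_act_eq_preimage, Set.mem_preimage, ← map_neg, Prod.neg_mk,
    dyadicCircleAction_shearEquiv, towerBase, Set.mem_prod, Set.mem_prod]
  refine and_congr ?_ ?_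
  · simp only [Set.mem_preimage, Set.mem_singleton_iff, map_add, FiniteIndexChain.coord_diag,
      QuotientAddGroup.mk_neg]
    rw [neg_add_eq_zero, eq_comm]
  · rw [arc, Metric.mem_closedBall, Metric.mem_closedBall, dist_zero_right, dist_eq_norm,
      neg_smul, neg_add_eq_sub]

theorem coe_eq_coe_dyadicChain_iff {n : ℕ} {i i' : ℤ} :
    (i : ℤ ⧸ dyadicChain.grp n) = i' ↔ (2 ^ (n + 1) : ℤ) ∣ i' - i := by
  rw [QuotientAddGroup.eq, neg_add_eq_sub]
  exact Int.mem_zmultiples_iff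

theorem isFolnerRankOne_dyadicCircleAction {α : ℝ} (hα : Liouville α) :
    (dyadicCircleAction α).IsFolnerRankOne := by
  choose r hrn hr using hα.exists_rat_abs_sub_lt
  -- The arcs of radius `ρ n` around the first `(r n).den` multiples of `α` are disjoint, and miss
  -- only a proportion `δ n` of the circle.
  set δ : ℕ → ℝ := fun n => 1 / ((n : ℝ) + 2) with hδdef
  have hδ0 : ∀ n, 0 < δ n := fun n => by positivity
  have hδ1 : ∀ n, δ n < 1 := fun n => by
    rw [hδdef, div_lt_one (by positivity)]
    have : (0 : ℝ) ≤ n := n.cast_nonneg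
    linarith
  have hδ : ∀ n, |α - r n| < δ n / ((r n).den : ℝ) ^ 2 := fun n => by
    rw [hδdef, div_div]
    exact hr n
  set ρ : ℕ → ℝ := fun n => (1 - δ n) / (2 * (r n).den) with hρdef
  have hρ0 : ∀ n, 0 < ρ n := fun n =>
    div_pos (sub_pos.2 (hδ1 n)) (mul_pos two_pos (by exact_mod_cast (r n).den_pos))
  have hden : Tendsto (fun n => (r n).den) atTop atTop :=
    tendsto_atTop_mono (fun n => (hrn n).le) tendsto_id
  have hρlim : Tendsto ρ atTop (𝓝 0) := by
    refine squeeze_zero (fun n => (hρ0 n).le) (fun n => ?_)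
      (tendsto_const_nhds.div_atTop (tendsto_natCast_atTop_atTop.comp hden) :
        Tendsto (fun n => (1 : ℝ) / ((r n).den : ℝ)) atTop (𝓝 0))
    have : (0 : ℝ) < (r n).den := by exact_mod_cast (r n).den_pos
    exact div_le_div₀ zero_le_one (by linarith [hδ0 n]) this (by linarith)
  have hδlim : Tendsto δ atTop (𝓝 0) :=
    tendsto_const_nhds.div_atTop (tendsto_natCast_atTop_atTop.atTop_add tendsto_const_nhds)
  set P : ℕ → Finset (ℤ × ℤ) := fun n =>
    Finset.Ico (0 : ℤ) (2 ^ (n + 1) : ℕ) ×ˢ Finset.Ico (0 : ℤ) (r n).den with hP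
  have hfol : IsFolnerSeq P := isFolnerSeq_box (fun n => by positivity) (fun n => (r n).den_pos)
    ((tendsto_pow_atTop_atTop_of_one_lt one_lt_two).comp (tendsto_add_atTop_nat 1)) hden
  refine ⟨_, hfol.map shearEquiv, MPAction.isRankOneFor_of_shrinking
    (B := fun n => towerBase n (ρ n))
    (hfol.map shearEquiv).1 (fun n => ⟨?_, ?_, ?_⟩) ?_ ?_⟩
  · exact ((dyadicChain.isClopen_coord_preimage n {0}).2.measurableSet).prod
      Metric.isClosed_closedBall.measurableSet
  · rw [towerBase, Measure.prod_prod]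
    refine ENNReal.mul_pos ?_ (Metric.measure_closedBall_pos _ _ (hρ0 n)).ne'
    exact ((dyadicChain.isClopen_coord_preimage n {0}).2.measure_pos _
      ⟨0, map_zero (dyadicChain.coord n)⟩).ne'
  · intro v hv w hw hvw
    obtain ⟨⟨i, j⟩, hij, rfl⟩ := Finset.mem_map.1 hv
    obtain ⟨⟨i', j'⟩, hij', rfl⟩ := Finset.mem_map.1 hw
    change Disjoint ((dyadicCircleAction α).act (shearEquiv (i, j)) '' _)
      ((dyadicCircleAction α).act (shearEquiv (i', j')) '' _)
    rw [image_towerBase, image_towerBase, Set.disjoint_prod]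
    rw [hP, Finset.mem_product] at hij hij'
    by_cases hii : i = i'
    · exact Or.inr (disjoint_arc (hδ n) hij.2 hij'.2 fun hjj => hvw (by rw [hii, hjj]))
    · refine Or.inl ((Set.disjoint_singleton.2 fun h => hii ?_).preimage _)
      have h1 := Finset.mem_Ico.1 hij.1
      have h2 := Finset.mem_Ico.1 hij'.1
      push_cast at h1 h2
      have := Int.eq_zero_of_abs_lt_dvd (coe_eq_coe_dyadicChain_iff.1 h)
        (abs_lt.2 ⟨by linarith, by linarith⟩)
      linarith
  · have hle : ∀ n, dyadicChain.haar.prod (volume : Measure UnitAddCircle)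
        (⋃ v ∈ (P n).map shearEquiv.toEquiv.toEmbedding,
          (dyadicCircleAction α).act v '' towerBase n (ρ n))ᶜ ≤ ENNReal.ofReal (δ n) := fun n => by
      have hsub : (⋃ v ∈ (P n).map shearEquiv.toEquiv.toEmbedding,
          (dyadicCircleAction α).act v '' towerBase n (ρ n))ᶜ ⊆
            Set.univ ×ˢ (⋃ j ∈ Finset.Ico (0 : ℤ) (r n).den, arc α (ρ n) j)ᶜ := by
        refine fun p hp => ⟨trivial, fun hp2 => hp ?_⟩
        obtain ⟨j, hj, hpj⟩ := Set.mem_iUnion₂.1 hp2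
        obtain ⟨a, ha⟩ := QuotientAddGroup.mk_surjective (dyadicChain.coord n p.1)
        refine Set.mem_iUnion₂.2 ⟨shearEquiv (a % (2 ^ (n + 1) : ℕ), j),
          Finset.mem_map.2 ⟨_, Finset.mem_product.2 ⟨Finset.mem_Ico.2
            ⟨Int.emod_nonneg _ (by positivity), Int.emod_lt_of_pos _ (by positivity)⟩, hj⟩, rfl⟩,
          ?_⟩
        rw [image_towerBase]
        refine ⟨?_, hpj⟩
        rw [Set.mem_preimage, Set.mem_singleton_iff, ← ha, coe_eq_coe_dyadicChain_iff,
          ← dvd_neg, neg_sub]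
        push_cast
        exact Int.dvd_self_sub_emod
      refine (measure_mono hsub).trans ?_
      rw [Measure.prod_prod, measure_univ, one_mul,
        volume_compl_iUnion_arc (hδ0 n).le (hδ1 n).le (hδ n)]
    refine tendsto_of_tendsto_of_tendsto_of_le_of_le tendsto_const_nhds ?_ (fun _ => zero_le) hle
    simpa using ENNReal.tendsto_ofReal hδlim
  · rintro ⟨z, w⟩ U hU
    obtain ⟨V, hV, V', hV', hVU⟩ := mem_nhds_prod_iff.1 hU
    obtain ⟨k, hk⟩ := dyadicChain.exists_coord_preimage_subset hV
    obtain ⟨ε, hε, hεV⟩ := Metric.mem_nhds_iff.1 hV'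
    refine ⟨(dyadicChain.coord k ⁻¹' {dyadicChain.coord k z}) ×ˢ Metric.ball w (ε / 2),
      prod_mem_nhds ((dyadicChain.isClopen_coord_preimage k _).2.mem_nhds rfl)
        (Metric.ball_mem_nhds _ (half_pos hε)), ?_⟩
    filter_upwards [eventually_ge_atTop k,
      hρlim.eventually (gt_mem_nhds (show 0 < ε / 4 by positivity))] with n hkn hρn v hv
    obtain ⟨⟨i, j⟩, -, rfl⟩ := Finset.mem_map.1 hv
    change ((dyadicCircleAction α).act (shearEquiv (i, j)) '' _ ∩ _).Nonempty →
      (dyadicCircleAction α).act (shearEquiv (i, j)) '' _ ⊆ U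
    rw [image_towerBase]
    rintro ⟨y, ⟨hy1, hy2⟩, hyz, hyw⟩ p ⟨hp1, hp2⟩
    refine hVU ⟨hk _ ?_, hεV ?_⟩
    · rw [Set.mem_preimage, Set.mem_singleton_iff] at hp1 hy1 hyz
      rw [← hyz]
      exact dyadicChain.coord_eq_of_le hkn (hp1.trans hy1.symm)
    · rw [arc, Metric.mem_closedBall] at hp2 hy2
      rw [Metric.mem_ball] at hyw ⊢
      have h1 := dist_triangle p.2 y.2 w
      have h2 := dist_triangle_right p.2 y.2 (j • (α : UnitAddCircle))
      linarith

theorem mainTheorem10 :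
    ∃ T : MPAction (Fin 2 → ℤ) (volume : Measure unitInterval),
      T.IsFolnerRankOne ∧
      (∀ i : Fin 2, (T.cyclic (Pi.single i 1)).FactorsOnto dyadicOdometer) ∧
      ∀ (Y : Type*) [MeasurableSpace Y] (ν : Measure Y) [IsProbabilityMeasure ν]
        (S : MPAction (Fin 2 → ℤ) ν),
        S.IsOdometer → S.IsFree → ¬ T.FactorsOnto S := by
  have hα : Liouville (liouvilleNumber (2 : ℕ)) := liouville_liouvilleNumber (m := 2) le_rfl
  set α := liouvilleNumber (2 : ℕ)
  obtain ⟨F, N, hF, hN, hN0, hinj⟩ :=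
    exists_measurePreserving_unitInterval (dyadicChain.haar.prod (volume : Measure UnitAddCircle))
  obtain ⟨S, hSN, hSm, hS0, hS⟩ := (dyadicCircleAction α).exists_invariant_conull hN hN0
  have : StandardBorelSpace S := hSm.standardBorel
  have he : MeasurableEmbedding (S.domRestrict F) :=
    (hF.measurable.comp measurable_subtype_coe).measurableEmbedding
      (Set.injOn_iff_injective.1 (hinj.mono hSN))
  refine ⟨(dyadicCircleAction α).transport hF he hS0 hS, ?_, fun i => ?_, ?_⟩
  · obtain ⟨R, hR, hT⟩ := isFolnerRankOne_dyadicCircleAction hα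
    exact ⟨R, hR, MPAction.isRankOneFor_transport hF he hS0 hS hT⟩
  · obtain ⟨ψ, hψ⟩ := MPAction.exists_isFactorMap_of_transport hF he hS0 hS
    exact ⟨_, (isFactorMap_fst_dyadicCircleAction α i).comp (hψ.cyclic _)⟩
  · rintro Y _ ν _ R ⟨𝔊, hconj⟩ hfree ⟨φ, hφ⟩
    obtain ⟨χ, hχ, -⟩ := id hconj
    have hmem := mem_grp_of_isFactorMap_dyadicCircleAction hα.irrational
      (hχ.comp (hφ.comp (MPAction.isFactorMap_transport hF he hS0 hS)))
    have := congrFun (hfree.eq_zero_of_isConjugate_odometer hconj hmem) 0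
    simp at this
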